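/- Let $n\ge 0$ and let $\mathfrak S_n$ be the symmetric group on $[n]=\{1,\dots,n\}$. For $w\in\mathfrak S_n$ let $\ell(w)=|\{(i,j)\in[n]^2: i<j,\ w(i)>w(j)\}|$ be its Coxeter length, and let its odd diagram be $$D_o(w)=\{(i,j)\in[n]^2 : j<w(i),\ i<w^{-1}(j),\ i\not\equiv w^{-1}(j) \pmod 2\}.$$ The Bruhat order $\le$ on $\mathfrak S_n$ is the reflexive and transitive closure of the relation $u\to v$ defined by: $vu^{-1}$ is a transposition and $\ell(u)<\ell(v)$. Theorem. Let $D\subseteq[n]^2$ be an odd diagram, that is, $D=D_o(w)$ for some $w\in\mathfrak S_n$. Then the set $\mathrm{Perm}_n(D)=\{w\in\mathfrak S_n : D_o(w)=D\}$ is a Bruhat interval: there are $u,v\in\mathfrak S_n$ with $u\le v$ and $$\mathrm{Perm}_n(D)=[u,v]=\{w\in\mathfrak S_n : u\le w\le v\}.$$ -/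

import Mathlib

/-! Permutations of `[n]` are modelled by `Equiv.Perm (Fin n)`. The indices start at `0` instead
of `1`; only comparisons of indices and parities of differences of indices are used, so this shift
is immaterial. -/

/-- The set of inversions of `w`: the pairs of positions `i < j` with `w i > w j`. -/
def inversionSet {n : ℕ} (w : Equiv.Perm (Fin n)) : Finset (Fin n × Fin n) :=
  Finset.univ.filter fun p => p.1 < p.2 ∧ w p.2 < w p.1

/-- The length of a permutation: its number of inversions. It is the Coxeter length with respect
to the adjacent transpositions, see `permLength_isLeast`. -/
def permLength {n : ℕ} (w : Equiv.Perm (Fin n)) : ℕ := (inversionSet w).card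

/-- The simple (adjacent) transpositions `(i i+1)`. -/
def IsSimpleTransposition {n : ℕ} (s : Equiv.Perm (Fin n)) : Prop :=
  ∃ i j : Fin n, (i : ℕ) + 1 = j ∧ s = Equiv.swap i j

/-- The edges `u → v` of the Bruhat graph: `v * u⁻¹` is a transposition and `ℓ(u) < ℓ(v)`. -/
def BruhatArrow {n : ℕ} (u v : Equiv.Perm (Fin n)) : Prop :=
  (v * u⁻¹).IsSwap ∧ permLength u < permLength v

/-- The Bruhat order: the reflexive and transitive closure of the Bruhat graph. -/
def BruhatLE {n : ℕ} (u v : Equiv.Perm (Fin n)) : Prop :=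
  Relation.ReflTransGen BruhatArrow u v

/-- The closed interval `[u, v]` in Bruhat order. -/
def bruhatInterval {n : ℕ} (u v : Equiv.Perm (Fin n)) : Set (Equiv.Perm (Fin n)) :=
  {w | BruhatLE u w ∧ BruhatLE w v}

/-- The diagram `D(w)`: the cells `(i, j)` with `j < w i` and `i < w⁻¹ j`. -/
def permDiagram {n : ℕ} (w : Equiv.Perm (Fin n)) : Set (Fin n × Fin n) :=
  {p | p.2 < w p.1 ∧ p.1 < w⁻¹ p.2}

/-- The odd diagram `D_o(w)`: the cells `(i, j)` of the diagram of `w` such that `i` and `w⁻¹ j`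
have different parities. -/
def oddDiagram {n : ℕ} (w : Equiv.Perm (Fin n)) : Set (Fin n × Fin n) :=
  {p | p ∈ permDiagram w ∧ ¬ (p.1 : ℕ) ≡ (w⁻¹ p.2 : Fin n) [MOD 2]}

/-- `D ⊆ [n]²` is an odd diagram if it is the odd diagram of some permutation of `[n]`. -/
def IsOddDiagram {n : ℕ} (D : Set (Fin n × Fin n)) : Prop :=
  ∃ w : Equiv.Perm (Fin n), oddDiagram w = D

/-- The odd diagram class `Perm_n(D)`: the permutations of `[n]` whose odd diagram is `D`. -/
def oddDiagramClass {n : ℕ} (D : Set (Fin n × Fin n)) : Set (Equiv.Perm (Fin n)) :=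
  {w | oddDiagram w = D}

/-! ### The number of inversions is the Coxeter length -/

theorem mem_inversionSet {n : ℕ} (w : Equiv.Perm (Fin n)) (a b : Fin n) :
    (a, b) ∈ inversionSet w ↔ a < b ∧ w b < w a := by
  simp [inversionSet]

theorem permLength_one {n : ℕ} : permLength (1 : Equiv.Perm (Fin n)) = 0 := by
  refine Finset.card_eq_zero.mpr (Finset.eq_empty_of_forall_notMem ?_)
  rintro ⟨a, b⟩ h
  obtain ⟨h1, h2⟩ := (mem_inversionSet 1 a b).mp h
  exact absurd h1 (not_lt.mpr h2.le)

theorem permLength_mul_simple_of_descent {n : ℕ} (w : Equiv.Perm (Fin n)) {i j : Fin n}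
    (hij : (i : ℕ) + 1 = j) (h : w j < w i) :
    permLength (w * Equiv.swap i j) + 1 = permLength w := by
  classical
  have hlt : i < j := by rw [Fin.lt_def]; omega
  have hmem : (i, j) ∈ inversionSet w := by simp [inversionSet, hlt, h]
  have hstep : ∀ a b : Fin n, a < b → (a, b) ≠ (i, j) →
      Equiv.swap i j a < Equiv.swap i j b := by
    intro a b hab hne
    have hne' : ¬ (a = i ∧ b = j) := by simpa [Prod.ext_iff] using hne
    rw [Equiv.swap_apply_def, Equiv.swap_apply_def]
    simp only [Fin.ext_iff, Fin.lt_def] at *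
    split_ifs <;> omega
  have hcard : (inversionSet (w * Equiv.swap i j)).card = ((inversionSet w).erase (i, j)).card := by
    refine Finset.card_bij (fun p _ => (Equiv.swap i j p.1, Equiv.swap i j p.2)) ?_ ?_ ?_
    · rintro ⟨a, b⟩ hp
      simp only [mem_inversionSet, Equiv.Perm.mul_apply] at hp
      have hne : (a, b) ≠ (i, j) := by
        intro he
        obtain ⟨rfl, rfl⟩ := Prod.mk.inj he
        have := hp.2
        simp only [Equiv.swap_apply_left, Equiv.swap_apply_right] at this
        exact absurd h (not_lt.mpr this.le)
      refine Finset.mem_erase.mpr ⟨?_, ?_⟩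
      · intro he
        obtain ⟨h1, h2⟩ := Prod.mk.inj he
        have ha : a = j := by rw [← Equiv.swap_apply_self i j a, h1, Equiv.swap_apply_left]
        have hb : b = i := by rw [← Equiv.swap_apply_self i j b, h2, Equiv.swap_apply_right]
        subst ha hb
        exact absurd hlt (not_lt.mpr hp.1.le)
      · rw [mem_inversionSet]
        exact ⟨hstep a b hp.1 hne, hp.2⟩
    · rintro ⟨a, b⟩ _ ⟨c, d⟩ _ he
      simpa using he
    · rintro ⟨a, b⟩ hp
      obtain ⟨hne, hp⟩ := Finset.mem_erase.mp hp
      rw [mem_inversionSet] at hp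
      refine ⟨(Equiv.swap i j a, Equiv.swap i j b), ?_, by simp⟩
      simp only [mem_inversionSet, Equiv.Perm.mul_apply, Equiv.swap_apply_self]
      exact ⟨hstep a b hp.1 hne, hp.2⟩
  unfold permLength
  rw [hcard]
  exact Finset.card_erase_add_one hmem

theorem permLength_mul_simple_le {n : ℕ} (w s : Equiv.Perm (Fin n))
    (hs : IsSimpleTransposition s) : permLength (w * s) ≤ permLength w + 1 := by
  obtain ⟨i, j, hij, rfl⟩ := hs
  have hne : i ≠ j := by rintro rfl; omega
  rcases lt_or_gt_of_ne (fun he => hne (w.injective he)) with h | h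
  · have := permLength_mul_simple_of_descent (w * Equiv.swap i j) hij (by simpa using h)
    rw [mul_assoc, Equiv.swap_mul_self, mul_one] at this
    omega
  · have := permLength_mul_simple_of_descent w hij h
    omega

theorem exists_descent {n : ℕ} (w : Equiv.Perm (Fin n)) (hw : w ≠ 1) :
    ∃ i j : Fin n, (i : ℕ) + 1 = j ∧ w j < w i := by
  by_contra hcon
  push Not at hcon
  apply hw
  cases n with
  | zero => exact Subsingleton.elim _ _
  | succ m =>
    have hmono : StrictMono w := Fin.strictMono_iff_lt_succ.mpr fun i =>
      lt_of_le_of_ne (hcon i.castSucc i.succ (by simp))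
        (fun he => absurd (w.injective he) (Fin.castSucc_lt_succ).ne)
    have : (hmono.orderIsoOfSurjective w w.surjective) = OrderIso.refl _ := Subsingleton.elim _ _
    ext i
    have h2 := congrArg (fun e : Fin (m + 1) ≃o Fin (m + 1) => e i) this
    simpa using congrArg Fin.val h2

/-- The number of inversions of `w` is the least length of a word in the simple transpositions
whose product is `w`. -/
theorem permLength_isLeast {n : ℕ} (w : Equiv.Perm (Fin n)) :
    IsLeast {k : ℕ | ∃ l : List (Equiv.Perm (Fin n)),
      (∀ s ∈ l, IsSimpleTransposition s) ∧ l.prod = w ∧ l.length = k} (permLength w) := by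
  constructor
  · induction hk : permLength w generalizing w with
    | zero =>
      by_cases hw : w = 1
      · exact ⟨[], by simp, by simp [hw], rfl⟩
      · obtain ⟨i, j, hij, h⟩ := exists_descent w hw
        have := permLength_mul_simple_of_descent w hij h
        omega
    | succ k ih =>
      by_cases hw : w = 1
      · subst hw
        have h0 : permLength (1 : Equiv.Perm (Fin n)) = 0 := permLength_one
        omega
      · obtain ⟨i, j, hij, h⟩ := exists_descent w hw
        have := permLength_mul_simple_of_descent w hij h
        obtain ⟨l, hl, hp, hlen⟩ := ih (w * Equiv.swap i j) (by omega)
        refine ⟨l ++ [Equiv.swap i j], ?_, ?_, by simp [hlen]⟩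
        · intro s hs
          rcases List.mem_append.mp hs with hs | hs
          · exact hl s hs
          · exact ⟨i, j, hij, by simpa using hs⟩
        · rw [List.prod_append, hp, List.prod_singleton, mul_assoc, Equiv.swap_mul_self, mul_one]
  · rintro k ⟨l, hl, rfl, rfl⟩
    induction l using List.reverseRecOn with
    | nil => simp [permLength_one]
    | append_singleton l s ih =>
      have h1 := ih fun t ht => hl t (by simp [ht])
      have h2 := permLength_mul_simple_le l.prod s (hl s (by simp))
      simp only [List.prod_append, List.prod_singleton, List.length_append, List.length_singleton]
      omega

/-! Call the points `(i, w i)` the dots of `w`, each with the parity of its position. Two facts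
about an odd diagram class are needed: it has a Bruhat least and a Bruhat greatest element, and it
is convex.

Both rest on rigidity. The odd diagram determines the parity of the position of every value
(`position_parity_eq`), and rays going left and down from the dots of one member separate the
opposite-parity dots of any other member in the same way (`value_lt_apply_iff`,
`position_lt_inv_iff`). Consequently, at the first position where two members differ, one swap moves
either of them within the class (`linked_of_first_difference`), so members of extreme length are
Bruhat extremes.

For convexity, count the dots with position `< x` and value `≥ y`, separately by parity. Two members
never differ in both counts at one place (`parityRank_eq_or_eq`). If `w → w * swap i k ≤ v` with
`w`, `v` in the class, the total counts of `w` and `v` differ on a whole rectangle, where a single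
parity must account for the difference. A dot that would prevent the swap from preserving the
diagram makes the counts of that parity agree somewhere in the rectangle, a contradiction
(`linked_of_bruhatRank_le`). -/

theorem perm_inv_apply {α : Type*} (w : Equiv.Perm α) (i : α) : w⁻¹ (w i) = i :=
  w.symm_apply_apply i

theorem perm_apply_inv {α : Type*} (w : Equiv.Perm α) (i : α) : w (w⁻¹ i) = i :=
  w.apply_symm_apply i

theorem mem_oddDiagram {n : ℕ} (w : Equiv.Perm (Fin n)) (i b : Fin n) :
    (i, b) ∈ oddDiagram w ↔
      b < w i ∧ i < w⁻¹ b ∧ (i : ℕ) % 2 ≠ ((w⁻¹ b : Fin n) : ℕ) % 2 := by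
  simp [oddDiagram, permDiagram, Nat.ModEq, and_assoc]

theorem mem_oddDiagram_apply {n : ℕ} (w : Equiv.Perm (Fin n)) (i m : Fin n) :
    (i, w m) ∈ oddDiagram w ↔ w m < w i ∧ i < m ∧ (i : ℕ) % 2 ≠ (m : ℕ) % 2 := by
  simp [mem_oddDiagram]

theorem odd_inversion_transfer {n : ℕ} {w v : Equiv.Perm (Fin n)}
    (h : oddDiagram w = oddDiagram v) {i b : Fin n} (h1 : b < w i) (h2 : i < w⁻¹ b)
    (h3 : (i : ℕ) % 2 ≠ ((w⁻¹ b : Fin n) : ℕ) % 2) :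
    b < v i ∧ i < v⁻¹ b ∧ (i : ℕ) % 2 ≠ ((v⁻¹ b : Fin n) : ℕ) % 2 := by
  rw [← mem_oddDiagram, ← h, mem_oddDiagram]
  exact ⟨h1, h2, h3⟩

/-- Pigeonhole: an injection cannot map the finite set `X` into `X` minus a point. It is applied
below to `w⁻¹ ∘ v` and `v⁻¹ ∘ w`. -/
theorem Finset.exists_notMem_of_injective_of_avoids {α : Type*} [DecidableEq α] {X : Finset α}
    {g : α → α} (hg : Function.Injective g) {p : α} (hp : p ∈ X) (hne : ∀ i ∈ X, g i ≠ p) :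
    ∃ i ∈ X, g i ∉ X := by
  by_contra hcon
  push Not at hcon
  have hsub : X.image g ⊆ X.erase p := by
    intro y hy
    obtain ⟨i, hi, rfl⟩ := Finset.mem_image.mp hy
    exact Finset.mem_erase.mpr ⟨hne i hi, hcon i hi⟩
  have h1 := Finset.card_le_card hsub
  rw [Finset.card_image_of_injective _ hg] at h1
  have h2 := Finset.card_erase_lt_of_mem hp
  omega

/-! ### The parity of the position of a value -/

/-- Pigeonhole for `w⁻¹ ∘ v` on the positions below `t` of the parity of `w⁻¹ j`: the values there
are below `j`, so parity is kept and `w⁻¹ j` is avoided; the set can only be left past `t`. The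
bound `t` is a natural number so that `t = n` is allowed, where the conclusion is absurd. -/
theorem exists_value_moved_right {n : ℕ} {w v : Equiv.Perm (Fin n)} {j : Fin n}
    (hpar : ∀ a < j, ((w⁻¹ a : Fin n) : ℕ) % 2 = ((v⁻¹ a : Fin n) : ℕ) % 2)
    (t : ℕ) (hp : ((w⁻¹ j : Fin n) : ℕ) < t)
    (hv : ∀ i : Fin n, (i : ℕ) < t → (i : ℕ) % 2 = ((w⁻¹ j : Fin n) : ℕ) % 2 → v i < j) :
    ∃ i : Fin n, (i : ℕ) < t ∧ v i < j ∧ t ≤ (w⁻¹ (v i) : Fin n) ∧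
      ((w⁻¹ (v i) : Fin n) : ℕ) % 2 = ((w⁻¹ j : Fin n) : ℕ) % 2 := by
  classical
  obtain ⟨i, hi, hn⟩ := Finset.exists_notMem_of_injective_of_avoids
    (X := Finset.univ.filter fun i : Fin n =>
      (i : ℕ) < t ∧ (i : ℕ) % 2 = ((w⁻¹ j : Fin n) : ℕ) % 2)
    (g := fun i => w⁻¹ (v i)) ((w⁻¹).injective.comp v.injective) (p := w⁻¹ j)
    (by simpa using hp) (by
      intro i hi he
      simp only [Finset.mem_filter, Finset.mem_univ, true_and] at hi
      exact (hv i hi.1 hi.2).ne ((w⁻¹).injective he))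
  simp only [Finset.mem_filter, Finset.mem_univ, true_and, not_and] at hi hn
  have hlt := hv i hi.1 hi.2
  have hq := hpar (v i) hlt
  rw [perm_inv_apply] at hq
  refine ⟨i, hi.1, hlt, ?_, hq.trans hi.2⟩
  by_contra hc
  exact hn (not_le.mp hc) (hq.trans hi.2)

/-- If `j < w t`, then `t` is to the right of `w⁻¹ j`, and some value `v i < j` with `i < t` is to
the right of `t` in `w`. It forms an odd inversion with `t` in `w`, hence also in `v`, which
contradicts `i < t`. -/
theorem lt_of_odd_position {n : ℕ} {w v : Equiv.Perm (Fin n)} (h : oddDiagram w = oddDiagram v)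
    {j : Fin n} (hpar : ∀ a < j, ((w⁻¹ a : Fin n) : ℕ) % 2 = ((v⁻¹ a : Fin n) : ℕ) % 2)
    (hj : ((w⁻¹ j : Fin n) : ℕ) % 2 ≠ ((v⁻¹ j : Fin n) : ℕ) % 2) (t : Fin n)
    (hv : ∀ i : Fin n, i < t → (i : ℕ) % 2 ≠ ((v⁻¹ j : Fin n) : ℕ) % 2 → v i < j)
    (ht : (t : ℕ) % 2 ≠ ((w⁻¹ j : Fin n) : ℕ) % 2) : w t < j := by
  by_contra hc
  have hne : j ≠ w t := by
    rintro rfl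
    simp at ht
  have hlt : j < w t := lt_of_le_of_ne (not_lt.mp hc) hne
  have hpt : w⁻¹ j < t := by
    by_contra hpt
    have hne' : t ≠ w⁻¹ j := fun he => ht (by rw [he])
    have := odd_inversion_transfer h hlt (lt_of_le_of_ne (not_lt.mp hpt) hne') ht
    omega
  obtain ⟨i, hit, hij, hq, hqp⟩ := exists_value_moved_right hpar t hpt
    (fun i hi hip => hv i hi (by omega))
  have hlt' : t < w⁻¹ (v i) := by
    refine lt_of_le_of_ne (Fin.le_def.mpr hq) ?_
    intro he
    rw [← he] at hqp
    exact ht hqp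
  have := (odd_inversion_transfer h (hij.trans hlt) hlt' (by rw [hqp]; exact ht)).2.1
  rw [perm_inv_apply] at this
  exact absurd this (not_lt.mpr (Fin.le_def.mpr hit.le))

/-- Permutations with the same odd diagram have every value at positions of the same parity. -/
theorem position_parity_eq {n : ℕ} {w v : Equiv.Perm (Fin n)} (h : oddDiagram w = oddDiagram v)
    (j : Fin n) : ((w⁻¹ j : Fin n) : ℕ) % 2 = ((v⁻¹ j : Fin n) : ℕ) % 2 := by
  induction j using WellFoundedLT.induction with
  | ind j hpar =>
  by_contra hj
  -- The claims for `w` and `v` are proved jointly: each at `t` uses the other at smaller positions.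
  have key : ∀ t : Fin n, ((t : ℕ) % 2 ≠ ((w⁻¹ j : Fin n) : ℕ) % 2 → w t < j) ∧
      ((t : ℕ) % 2 ≠ ((v⁻¹ j : Fin n) : ℕ) % 2 → v t < j) := by
    intro t
    induction t using WellFoundedLT.induction with
    | ind t ih =>
    exact ⟨lt_of_odd_position h hpar hj t fun i hi => (ih i hi).2,
      lt_of_odd_position h.symm (fun a ha => (hpar a ha).symm) (Ne.symm hj) t
        fun i hi => (ih i hi).1⟩
  obtain ⟨i, -, -, hq, -⟩ := exists_value_moved_right hpar n (w⁻¹ j).isLt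
    (fun i _ hip => (key i).2 (by omega))
  have := (w⁻¹ (v i)).isLt
  omega

theorem parity_inv_apply {n : ℕ} {w v : Equiv.Perm (Fin n)} (h : oddDiagram w = oddDiagram v)
    (i : Fin n) : ((w⁻¹ (v i) : Fin n) : ℕ) % 2 = (i : ℕ) % 2 := by
  simpa using position_parity_eq h (v i)

theorem apply_ne_apply_of_parity_ne {n : ℕ} {w v : Equiv.Perm (Fin n)}
    (h : oddDiagram w = oddDiagram v) {i m : Fin n} (him : (i : ℕ) % 2 ≠ (m : ℕ) % 2) :
    w i ≠ v m := by
  intro he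
  have := parity_inv_apply h m
  rw [← he, perm_inv_apply] at this
  exact him this

/-! ### Rows and columns of the two parities are independent -/

/-- Pigeonhole for `w⁻¹ ∘ v` on the positions `k < t` of the parity of `i` with `v k < b`. It avoids
`i` since `b < w i`, and by `hv` an image below `t` stays in the set. -/
theorem exists_small_value_moved_right {n : ℕ} {w v : Equiv.Perm (Fin n)}
    (h : oddDiagram w = oddDiagram v) {i b : Fin n} (hwi : b < w i) (hvi : v i < b) (t : ℕ)
    (hit : (i : ℕ) < t)
    (hv : ∀ k : Fin n, (k : ℕ) < t → (k : ℕ) % 2 = (i : ℕ) % 2 → b ≤ v k → b ≤ w k) :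
    ∃ k : Fin n, (k : ℕ) < t ∧ v k < b ∧ t ≤ (w⁻¹ (v k) : Fin n) ∧
      ((w⁻¹ (v k) : Fin n) : ℕ) % 2 = (i : ℕ) % 2 := by
  classical
  obtain ⟨k, hk, hn⟩ := Finset.exists_notMem_of_injective_of_avoids
    (X := Finset.univ.filter fun k : Fin n =>
      (k : ℕ) < t ∧ (k : ℕ) % 2 = (i : ℕ) % 2 ∧ v k < b)
    (g := fun k => w⁻¹ (v k)) ((w⁻¹).injective.comp v.injective) (p := i)
    (by simpa using ⟨hit, hvi⟩) (by
      intro k hk he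
      simp only [Finset.mem_filter, Finset.mem_univ, true_and] at hk
      have : v k = w i := by rw [← he, perm_apply_inv]
      exact absurd (this ▸ hk.2.2) (not_lt.mpr hwi.le))
  simp only [Finset.mem_filter, Finset.mem_univ, true_and, not_and, not_lt] at hk hn
  have hq := (parity_inv_apply h k).trans hk.2.1
  refine ⟨k, hk.1, hk.2.2, ?_, hq⟩
  by_contra hc
  have h1 := hv _ (not_le.mp hc) hq (hn (not_le.mp hc) hq)
  rw [perm_apply_inv] at h1
  exact absurd hk.2.2 (not_lt.mpr h1)

theorem lt_position_transfer {n : ℕ} {w v : Equiv.Perm (Fin n)} (h : oddDiagram w = oddDiagram v)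
    {i b : Fin n} (hib : (i : ℕ) % 2 ≠ ((w⁻¹ b : Fin n) : ℕ) % 2) (hwi : b < w i)
    (hi : i < v⁻¹ b) : i < w⁻¹ b := by
  by_contra hcon
  have hpb := position_parity_eq h b
  have hqi : w⁻¹ b < i := lt_of_le_of_ne (not_lt.mp hcon) (fun he => hib (by rw [he]))
  have hcol : ∀ k : Fin n, (k : ℕ) % 2 = (i : ℕ) % 2 → k < v⁻¹ b → b ≤ v k →
      b < w k ∧ k < w⁻¹ b := by
    intro k hk hkq hbk
    have hne : b ≠ v k := by
      rintro rfl
      simp at hkq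
    have := odd_inversion_transfer h.symm (lt_of_le_of_ne hbk hne) hkq (by omega)
    exact ⟨this.1, this.2.1⟩
  have hvi : v i < b := by
    by_contra hc
    exact absurd (hcol i rfl hi (not_lt.mp hc)).2 hcon
  -- If `w⁻¹ b < i`, no value above `b` can occur in `w` at opposite parity right of `i`, nor in `v`
  -- at the parity of `i` right of `v⁻¹ b`. The two claims feed each other by induction on `t`.
  have key : ∀ t : Fin n,
      ((t : ℕ) % 2 ≠ (i : ℕ) % 2 → i < t → w t < b) ∧
      ((t : ℕ) % 2 = (i : ℕ) % 2 → v⁻¹ b < t → v t < b) := by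
    intro t
    induction t using WellFoundedLT.induction with
    | ind t ih =>
    constructor
    · intro ht hit
      by_contra hc
      have hne : b ≠ w t := by
        rintro rfl
        rw [perm_inv_apply] at hqi
        exact absurd hqi (not_lt.mpr hit.le)
      obtain ⟨k, hkt, hkb, hq, hqp⟩ := exists_small_value_moved_right h hwi hvi t hit (by
        intro k hkt hki hbk
        rcases lt_trichotomy k (v⁻¹ b) with hk | hk | hk
        · exact (hcol k hki hk hbk).1.le
        · rw [hk] at hki
          omega
        · exact absurd ((ih k hkt).2 hki hk) (not_lt.mpr hbk))
      have hlt : t < w⁻¹ (v k) := by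
        refine lt_of_le_of_ne (Fin.le_def.mpr hq) ?_
        intro he
        rw [← he] at hqp
        exact ht hqp
      have := (odd_inversion_transfer h (hkb.trans (lt_of_le_of_ne (not_lt.mp hc) hne)) hlt
        (by omega)).2.1
      rw [perm_inv_apply] at this
      exact absurd this (not_lt.mpr (Fin.le_def.mpr hkt.le))
    · intro ht hqt
      by_contra hc
      have hne : b ≠ v t := by
        rintro rfl
        simp at hqt
      have hbt : b < v t := lt_of_le_of_ne (not_lt.mp hc) hne
      classical
      -- Pigeonhole on the opposite-parity positions between `i` and `t`: their `w`-values are below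
      -- `b`, so `v⁻¹ b` is avoided. The odd inversion with `i` keeps images right of `i`, so one
      -- lands beyond `t`.
      obtain ⟨m, hm, hn⟩ := Finset.exists_notMem_of_injective_of_avoids
        (X := Finset.univ.filter fun m : Fin n => i < m ∧ m < t ∧ (m : ℕ) % 2 ≠ (i : ℕ) % 2)
        (g := fun m => v⁻¹ (w m)) ((v⁻¹).injective.comp w.injective) (p := v⁻¹ b)
        (by
          simp only [Finset.mem_filter, Finset.mem_univ, true_and]
          exact ⟨hi, hqt, by omega⟩) (by
          intro m hm he
          simp only [Finset.mem_filter, Finset.mem_univ, true_and] at hm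
          exact ((ih m hm.2.1).1 hm.2.2 hm.1).ne ((v⁻¹).injective he))
      simp only [Finset.mem_filter, Finset.mem_univ, true_and] at hm hn
      have hmb := (ih m hm.2.1).1 hm.2.2 hm.1
      have hpm := parity_inv_apply h.symm m
      have h1 : i < v⁻¹ (w m) :=
        (odd_inversion_transfer h (b := w m) (hmb.trans hwi) (by simpa using hm.1)
          (by simpa using hm.2.2.symm)).2.1
      refine hn ⟨h1, ?_, by omega⟩
      by_contra hc'
      have hlt : t < v⁻¹ (w m) := lt_of_le_of_ne (not_lt.mp hc') (by
        intro he
        rw [← he] at hpm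
        omega)
      have := (odd_inversion_transfer h.symm (hmb.trans hbt) hlt (by omega)).2.1
      rw [perm_inv_apply] at this
      exact absurd this (not_lt.mpr hm.2.1.le)
  obtain ⟨k, -, -, hq, -⟩ := exists_small_value_moved_right h hwi hvi n i.isLt (by
    intro k _ hki hbk
    rcases lt_trichotomy k (v⁻¹ b) with hk | hk | hk
    · exact (hcol k hki hk hbk).1.le
    · rw [hk] at hki
      omega
    · exact absurd ((key k).2 hki hk) (not_lt.mpr hbk))
  have := (w⁻¹ (v k)).isLt
  omega

/-- For permutations `z`, `v` with the same odd diagram, the down-going ray of a dot of `z`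
separates the dots of `z` of the other parity as it separates those of `v`. -/
theorem position_lt_inv_iff {n : ℕ} {z v : Equiv.Perm (Fin n)} (h : oddDiagram z = oddDiagram v)
    {m a : Fin n} (hm : (m : ℕ) % 2 ≠ ((z⁻¹ a : Fin n) : ℕ) % 2) (ha : a < z m) :
    m < v⁻¹ a ↔ m < z⁻¹ a :=
  ⟨lt_position_transfer h hm ha, fun h1 => (odd_inversion_transfer h ha h1 hm).2.1⟩

/-- For permutations `z`, `v` with the same odd diagram, the left-going ray of a dot of `z`
separates the dots of `z` of the other parity as it separates those of `v`. -/
theorem value_lt_apply_iff {n : ℕ} {z v : Equiv.Perm (Fin n)} (h : oddDiagram z = oddDiagram v)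
    {i m : Fin n} (him : (i : ℕ) % 2 ≠ (m : ℕ) % 2) (hlt : i < m) :
    z m < v i ↔ z m < z i := by
  have hp := parity_inv_apply h.symm m
  constructor
  · intro h1
    have h2 : i < v⁻¹ (z m) := lt_position_transfer h.symm (by omega) h1 (by simpa using hlt)
    exact (odd_inversion_transfer h.symm h1 h2 (by omega)).1
  · intro h1
    exact (odd_inversion_transfer h h1 (by simpa using hlt) (by simpa using him)).1

/-! ### Moves inside an odd diagram class -/

/-- The positions `i < k` are linked in `w` if they have the same parity, the values of `w` between
them at positions of the other parity are smaller than `w i` and `w k`, and no value to their right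
at a position of the other parity lies between `w i` and `w k`. -/
def Linked {n : ℕ} (w : Equiv.Perm (Fin n)) (i k : Fin n) : Prop :=
  (i : ℕ) % 2 = (k : ℕ) % 2 ∧ i < k ∧ ∀ m : Fin n, (m : ℕ) % 2 ≠ (i : ℕ) % 2 → i < m →
    (m < k → w m < w i ∧ w m < w k) ∧ (k < m → (w m < w i ↔ w m < w k))

/-- The condition is symmetric in the two values, so a single inclusion of odd diagrams will
suffice. -/
theorem Linked.mul_swap {n : ℕ} {w : Equiv.Perm (Fin n)} {i k : Fin n} (h : Linked w i k) :
    Linked (w * Equiv.swap i k) i k := by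
  obtain ⟨hp, hik, h⟩ := h
  refine ⟨hp, hik, fun m hm him => ?_⟩
  have hmi : m ≠ i := by rintro rfl; exact hm rfl
  have hmk : m ≠ k := by rintro rfl; exact hm hp.symm
  simp only [Equiv.Perm.mul_apply, Equiv.swap_apply_left, Equiv.swap_apply_right,
    Equiv.swap_apply_of_ne_of_ne hmi hmk]
  exact ⟨fun hlt => ((h m hm him).1 hlt).symm, fun hlt => ((h m hm him).2 hlt).symm⟩

theorem oddDiagram_mul_swap_subset {n : ℕ} {w : Equiv.Perm (Fin n)} {i k : Fin n}
    (h : Linked w i k) : oddDiagram (w * Equiv.swap i k) ⊆ oddDiagram w := by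
  obtain ⟨hp, hik, h⟩ := h
  rintro ⟨p, b⟩ hpb
  obtain ⟨q, rfl⟩ := (w * Equiv.swap i k).surjective b
  obtain ⟨h1, h2, h3⟩ := (mem_oddDiagram_apply _ p q).mp hpb
  simp only [Equiv.Perm.mul_apply] at h1 ⊢
  rw [mem_oddDiagram_apply]
  by_cases hpi : p = i
  · subst hpi
    have hqk : q ≠ k := by rintro rfl; exact h3 hp
    rw [Equiv.swap_apply_left, Equiv.swap_apply_of_ne_of_ne h2.ne' hqk] at h1
    rw [Equiv.swap_apply_of_ne_of_ne h2.ne' hqk]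
    refine ⟨?_, h2, h3⟩
    rcases lt_or_gt_of_ne hqk with hlt | hlt
    · exact ((h q h3.symm h2).1 hlt).1
    · exact ((h q h3.symm h2).2 hlt).2 h1
  by_cases hpk : p = k
  · subst hpk
    have hqi : q ≠ i := by rintro rfl; exact h3 hp.symm
    rw [Equiv.swap_apply_right, Equiv.swap_apply_of_ne_of_ne hqi h2.ne'] at h1
    rw [Equiv.swap_apply_of_ne_of_ne hqi h2.ne']
    exact ⟨((h q (by omega) (hik.trans h2)).2 h2).1 h1, h2, h3⟩
  rw [Equiv.swap_apply_of_ne_of_ne hpi hpk] at h1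
  by_cases hqi : q = i
  · subst hqi
    rw [Equiv.swap_apply_left] at h1 ⊢
    exact ⟨h1, h2.trans hik, by omega⟩
  by_cases hqk : q = k
  · subst hqk
    rw [Equiv.swap_apply_right] at h1 ⊢
    refine ⟨h1, ?_, by omega⟩
    by_contra hc
    have hip : i < p := lt_of_le_of_ne (not_lt.mp hc) (Ne.symm hpi)
    exact absurd h1 (not_lt.mpr ((h p (by omega) hip).1 h2).1.le)
  rw [Equiv.swap_apply_of_ne_of_ne hqi hqk] at h1 ⊢
  exact ⟨h1, h2, h3⟩

theorem oddDiagram_mul_swap {n : ℕ} {w : Equiv.Perm (Fin n)} {i k : Fin n}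
    (h : Linked w i k) : oddDiagram (w * Equiv.swap i k) = oddDiagram w := by
  refine (oddDiagram_mul_swap_subset h).antisymm ?_
  simpa [mul_assoc] using oddDiagram_mul_swap_subset h.mul_swap

/-- The value `w i` must lie to the right of `i` in `v`. Comparing values at position `i` puts each
later opposite-parity dot of `v` on the same side of `w i` and `v i`; comparing the positions of `w
i` in `w` and `v` excludes larger such dots in between. -/
theorem linked_of_first_difference {n : ℕ} {w v : Equiv.Perm (Fin n)}
    (h : oddDiagram w = oddDiagram v) {i : Fin n} (hi : w i ≠ v i) (heq : ∀ j < i, w j = v j) :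
    Linked v i (v⁻¹ (w i)) := by
  have hpk := parity_inv_apply h.symm i
  have hvk := perm_apply_inv v (w i)
  set k := v⁻¹ (w i) with hk
  have hik : i < k := by
    rcases lt_trichotomy i k with hlt | he | hlt
    · exact hlt
    · rw [← he] at hvk
      exact absurd hvk.symm hi
    · have := heq k hlt
      rw [hvk] at this
      exact absurd (w.injective this) hlt.ne
  refine ⟨hpk.symm, hik, fun m hm him => ?_⟩
  have hrow := value_lt_apply_iff h.symm (i := i) (m := m) (by omega) him
  refine ⟨fun hmk => ?_, fun hkm => by rw [hvk]; exact hrow.symm⟩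
  have hlt : v m < v k := by
    by_contra hc
    have hne : v k ≠ v m := fun he => hmk.ne' (v.injective he)
    have hkm : v k < v m := lt_of_le_of_ne (not_lt.mp hc) hne
    have := (position_lt_inv_iff h.symm (m := m) (a := v k)
      (by rw [perm_inv_apply]; omega) hkm)
    rw [perm_inv_apply, hvk, perm_inv_apply] at this
    exact absurd (this.mpr hmk) (not_lt.mpr him.le)
  exact ⟨hrow.mp (by rwa [← hvk]), hlt⟩

/-! ### Transpositions and length -/

theorem permLength_lt_mul_swap {n : ℕ} {w : Equiv.Perm (Fin n)} {i k : Fin n} (hik : i < k)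
    (hw : w i < w k) : permLength w < permLength (w * Equiv.swap i k) := by
  classical
  have hcase : ∀ p q : Fin n, p < q → Equiv.swap i k q ≤ Equiv.swap i k p →
      (p = i ∧ q ≤ k) ∨ (q = k ∧ i < p) := by
    intro p q hpq hs
    rw [Equiv.swap_apply_def, Equiv.swap_apply_def] at hs
    split_ifs at hs <;> simp only [Fin.ext_iff, Fin.lt_def, Fin.le_def] at * <;> omega
  -- Relabel an inversion by the swap when that keeps its positions in order, and keep it otherwise.
  -- This injects the old inversions into the new ones and misses `(i, k)`.
  let f : Fin n × Fin n → Fin n × Fin n := fun p =>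
    if Equiv.swap i k p.1 < Equiv.swap i k p.2 then (Equiv.swap i k p.1, Equiv.swap i k p.2) else p
  have hinj : Set.InjOn f (inversionSet w) := by
    rintro ⟨p, q⟩ hpq ⟨p', q'⟩ hpq' he
    have h1 := ((mem_inversionSet w p q).mp hpq).1
    have h2 := ((mem_inversionSet w p' q').mp hpq').1
    simp only [f] at he
    split_ifs at he with c1 c2 c2
    · simpa using he
    · obtain ⟨e1, e2⟩ := Prod.mk.inj he
      rw [← e1, ← e2] at c2
      simp only [Equiv.swap_apply_self] at c2
      exact absurd h1 c2
    · obtain ⟨e1, e2⟩ := Prod.mk.inj he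
      rw [e1, e2] at c1
      simp only [Equiv.swap_apply_self] at c1
      exact absurd h2 c1
    · exact he
  have hsub : (inversionSet w).image f ⊆ (inversionSet (w * Equiv.swap i k)).erase (i, k) := by
    intro r hr
    obtain ⟨⟨p, q⟩, hpq, rfl⟩ := Finset.mem_image.mp hr
    obtain ⟨hpq, hinv⟩ := (mem_inversionSet w p q).mp hpq
    simp only [f]
    split_ifs with c
    · refine Finset.mem_erase.mpr ⟨?_, (mem_inversionSet _ _ _).mpr ⟨c, by simpa using hinv⟩⟩
      intro he
      obtain ⟨e1, e2⟩ := Prod.mk.inj he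
      rw [Equiv.swap_apply_eq_iff] at e1 e2
      rw [Equiv.swap_apply_left] at e1
      rw [Equiv.swap_apply_right] at e2
      subst e1 e2
      exact absurd hik (not_lt.mpr hpq.le)
    · have hne : ¬ (p = i ∧ q = k) := by
        rintro ⟨rfl, rfl⟩
        exact absurd hw (not_lt.mpr hinv.le)
      refine Finset.mem_erase.mpr ⟨fun he => hne (Prod.mk.inj he),
        (mem_inversionSet _ _ _).mpr ⟨hpq, ?_⟩⟩
      simp only [Equiv.Perm.mul_apply]
      rcases hcase p q hpq (not_lt.mp c) with ⟨rfl, hq⟩ | ⟨rfl, hp⟩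
      · have hqk : q ≠ k := fun he => hne ⟨rfl, he⟩
        rw [Equiv.swap_apply_left, Equiv.swap_apply_of_ne_of_ne hpq.ne' hqk]
        exact hinv.trans hw
      · rw [Equiv.swap_apply_right, Equiv.swap_apply_of_ne_of_ne hp.ne' hpq.ne]
        exact hw.trans hinv
  have hmem : (i, k) ∈ inversionSet (w * Equiv.swap i k) := by
    rw [mem_inversionSet]
    exact ⟨hik, by simpa using hw⟩
  have h1 := Finset.card_le_card hsub
  rw [Finset.card_image_of_injOn hinj] at h1
  have h2 := Finset.card_erase_lt_of_mem hmem
  unfold permLength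
  omega

theorem bruhatArrow_mul_swap {n : ℕ} {w : Equiv.Perm (Fin n)} {i k : Fin n} (hik : i < k)
    (hw : w i < w k) : BruhatArrow w (w * Equiv.swap i k) := by
  refine ⟨⟨w i, w k, hw.ne, ?_⟩, permLength_lt_mul_swap hik hw⟩
  rw [Equiv.swap_apply_apply]

theorem BruhatArrow.exists_eq_mul_swap {n : ℕ} {u v : Equiv.Perm (Fin n)} (h : BruhatArrow u v) :
    ∃ i k : Fin n, i < k ∧ u i < u k ∧ v = u * Equiv.swap i k := by
  obtain ⟨⟨a, b, hab, hs⟩, hlen⟩ := h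
  have hv : v = u * Equiv.swap (u⁻¹ a) (u⁻¹ b) := by
    rw [Equiv.swap_apply_apply, ← hs]
    group
  have key : ∀ i k : Fin n, i < k → v = u * Equiv.swap i k → u i < u k := by
    intro i k hik he
    by_contra hc
    have hki : u k < u i := lt_of_le_of_ne (not_lt.mp hc) fun e => hik.ne' (u.injective e)
    have := permLength_lt_mul_swap (w := v) hik (by rw [he]; simpa using hki)
    rw [he, mul_assoc, Equiv.swap_mul_self, mul_one, ← he] at this
    omega
  rcases lt_trichotomy (u⁻¹ a) (u⁻¹ b) with hlt | he | hlt
  · exact ⟨_, _, hlt, key _ _ hlt hv, hv⟩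
  · exact absurd ((u⁻¹).injective he) hab
  · rw [Equiv.swap_comm] at hv
    exact ⟨_, _, hlt, key _ _ hlt hv, hv⟩

/-! ### The extreme elements of an odd diagram class -/

theorem exists_first_difference {n : ℕ} {w v : Equiv.Perm (Fin n)} (h : w ≠ v) :
    ∃ i : Fin n, w i ≠ v i ∧ ∀ j < i, w j = v j := by
  classical
  have hex : ∃ i, w i ≠ v i := by
    by_contra hc
    push Not at hc
    exact h (Equiv.ext hc)
  obtain ⟨i, hi, hmin⟩ := WellFounded.has_min (wellFounded_lt (α := Fin n)) {i | w i ≠ v i} hex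
  exact ⟨i, hi, fun j hj => by_contra fun hc => hmin j hc hj⟩

theorem exists_ascending_move {n : ℕ} {w v : Equiv.Perm (Fin n)}
    (h : oddDiagram w = oddDiagram v) {i : Fin n} (heq : ∀ j < i, w j = v j) (hi : v i < w i) :
    ∃ v', oddDiagram v' = oddDiagram v ∧ BruhatArrow v v' := by
  have hl := linked_of_first_difference h hi.ne' heq
  exact ⟨_, oddDiagram_mul_swap hl, bruhatArrow_mul_swap hl.2.1 (by rwa [perm_apply_inv])⟩

theorem exists_descending_move {n : ℕ} {w v : Equiv.Perm (Fin n)}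
    (h : oddDiagram w = oddDiagram v) {i : Fin n} (heq : ∀ j < i, w j = v j) (hi : w i < v i) :
    ∃ v', oddDiagram v' = oddDiagram v ∧ BruhatArrow v' v := by
  have hl := linked_of_first_difference h hi.ne heq
  refine ⟨_, oddDiagram_mul_swap hl, ?_⟩
  have := bruhatArrow_mul_swap (w := v * Equiv.swap i (v⁻¹ (w i))) hl.2.1 (by
    simpa only [Equiv.Perm.mul_apply, Equiv.swap_apply_left, Equiv.swap_apply_right,
      perm_apply_inv] using hi)
  rwa [mul_assoc, Equiv.swap_mul_self, mul_one] at this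

/-- Take `v` of maximal length in the class. At the first difference with `w` the larger value
belongs to `v`, since otherwise `v` could ascend; hence `w` ascends within the class, closer to `v`
in length. -/
theorem exists_bruhat_greatest {n : ℕ} (w₀ : Equiv.Perm (Fin n)) :
    ∃ v, oddDiagram v = oddDiagram w₀ ∧
      ∀ w, oddDiagram w = oddDiagram w₀ → BruhatLE w v := by
  obtain ⟨v, hv, hmax⟩ := Set.exists_max_image {w | oddDiagram w = oddDiagram w₀} permLength
    (Set.toFinite _) ⟨w₀, rfl⟩
  refine ⟨v, hv, fun w hw => ?_⟩
  induction hN : permLength v - permLength w using Nat.strong_induction_on generalizing w with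
  | _ N ih =>
  by_cases hne : w = v
  · exact hne ▸ Relation.ReflTransGen.refl
  obtain ⟨i, hi, heq⟩ := exists_first_difference hne
  rcases lt_or_gt_of_ne hi with hlt | hlt
  · obtain ⟨w', hw', harr⟩ := exists_ascending_move (Eq.trans hv hw.symm)
      (fun j hj => (heq j hj).symm) hlt
    have hlen := hmax w' (Eq.trans hw' hw)
    have := harr.2
    exact Relation.ReflTransGen.head harr (ih _ (by omega) w' (hw'.trans hw) rfl)
  · obtain ⟨v', hv', harr⟩ := exists_ascending_move (Eq.trans hw hv.symm) heq hlt
    exact absurd harr.2 (not_lt.mpr (hmax v' (Eq.trans hv' hv)))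

theorem exists_bruhat_least {n : ℕ} (w₀ : Equiv.Perm (Fin n)) :
    ∃ u, oddDiagram u = oddDiagram w₀ ∧
      ∀ w, oddDiagram w = oddDiagram w₀ → BruhatLE u w := by
  obtain ⟨u, hu, hmin⟩ := Set.exists_min_image {w | oddDiagram w = oddDiagram w₀} permLength
    (Set.toFinite _) ⟨w₀, rfl⟩
  refine ⟨u, hu, fun w hw => ?_⟩
  induction hN : permLength w using Nat.strong_induction_on generalizing w with
  | _ N ih =>
  by_cases hne : w = u
  · exact hne ▸ Relation.ReflTransGen.refl
  obtain ⟨i, hi, heq⟩ := exists_first_difference hne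
  rcases lt_or_gt_of_ne hi with hlt | hlt
  · obtain ⟨u', hu', harr⟩ := exists_descending_move (Eq.trans hw hu.symm) heq hlt
    exact absurd harr.2 (not_lt.mpr (hmin u' (Eq.trans hu' hu)))
  · obtain ⟨w', hw', harr⟩ := exists_descending_move (Eq.trans hu hw.symm)
      (fun j hj => (heq j hj).symm) hlt
    exact Relation.ReflTransGen.tail (ih _ (hN ▸ harr.2) w' (hw'.trans hw) rfl) harr

/-! ### Rank counts -/

/-- The number of positions `j < x` of parity `e` whose value is at least `y`. -/
def parityRank {n : ℕ} (e : ℕ) (w : Equiv.Perm (Fin n)) (x y : ℕ) : ℕ :=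
  (Finset.univ.filter fun j : Fin n => (j : ℕ) % 2 = e ∧ (j : ℕ) < x ∧ y ≤ w j).card

/-- The number of positions `j < x` whose value is at least `y`. -/
def bruhatRank {n : ℕ} (w : Equiv.Perm (Fin n)) (x y : ℕ) : ℕ :=
  (Finset.univ.filter fun j : Fin n => (j : ℕ) < x ∧ y ≤ w j).card

theorem bruhatRank_eq_add {n : ℕ} (w : Equiv.Perm (Fin n)) (x y : ℕ) {e f : ℕ} (he : e < 2)
    (hf : f < 2) (hef : e ≠ f) :
    bruhatRank w x y = parityRank e w x y + parityRank f w x y := by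
  unfold bruhatRank parityRank
  rw [← Finset.card_union_of_disjoint]
  · congr 1
    ext j
    simp only [Finset.mem_filter, Finset.mem_univ, true_and, Finset.mem_union]
    have : (j : ℕ) % 2 = e ∨ (j : ℕ) % 2 = f := by omega
    tauto
  · rw [Finset.disjoint_filter]
    intro j _ h1 h2
    exact hef (h1.1.symm.trans h2.1)

theorem bruhatRank_mul_swap {n : ℕ} {w : Equiv.Perm (Fin n)} {i k : Fin n}
    {x y : ℕ} (hi : (i : ℕ) < x) (hk : x ≤ (k : ℕ)) (hy : (w i : ℕ) < y)
    (hy' : y ≤ (w k : ℕ)) :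
    bruhatRank (w * Equiv.swap i k) x y = bruhatRank w x y + 1 := by
  classical
  unfold bruhatRank
  rw [← Finset.card_insert_of_notMem (a := i) (by simp; omega)]
  congr 1
  ext j
  simp only [Finset.mem_filter, Finset.mem_univ, true_and, Finset.mem_insert]
  rw [Equiv.Perm.mul_apply]
  by_cases hji : j = i
  · subst hji
    simp [hi, hy']
  by_cases hjk : j = k
  · subst hjk
    simp only [hji, Equiv.swap_apply_right, false_or]
    omega
  · simp [hji, Equiv.swap_apply_of_ne_of_ne hji hjk]

theorem bruhatRank_le_mul_swap {n : ℕ} {w : Equiv.Perm (Fin n)} {i k : Fin n} (hik : i < k)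
    (hw : w i < w k) (x y : ℕ) : bruhatRank w x y ≤ bruhatRank (w * Equiv.swap i k) x y := by
  classical
  rw [Fin.lt_def] at hik hw
  by_cases hy : (w i : ℕ) < y ∧ y ≤ (w k : ℕ)
  · by_cases hx : (i : ℕ) < x ∧ x ≤ (k : ℕ)
    · rw [bruhatRank_mul_swap hx.1 hx.2 hy.1 hy.2]
      omega
    · unfold bruhatRank
      refine Finset.card_le_card_of_injOn (Equiv.swap i k) ?_ (Equiv.injective _).injOn
      intro j hj
      rw [Finset.mem_coe, Finset.mem_filter] at hj ⊢
      simp only [Finset.mem_univ, true_and, Equiv.Perm.mul_apply, Equiv.swap_apply_self] at hj ⊢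
      refine ⟨?_, hj.2⟩
      rw [Equiv.swap_apply_def]
      split_ifs with h1 h2
      · subst h1; omega
      · subst h2; omega
      · exact hj.1
  · unfold bruhatRank
    refine Finset.card_le_card ?_
    intro j hj
    rw [Finset.mem_filter] at hj ⊢
    simp only [Finset.mem_univ, true_and, Equiv.Perm.mul_apply] at hj ⊢
    refine ⟨hj.1, ?_⟩
    rw [Equiv.swap_apply_def]
    split_ifs with h1 h2
    · subst h1; omega
    · subst h2; omega
    · exact hj.2

/-- The easy half of the rank criterion for Bruhat order; the converse is not needed. -/
theorem BruhatLE.bruhatRank_le {n : ℕ} {u v : Equiv.Perm (Fin n)} (h : BruhatLE u v) (x y : ℕ) :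
    bruhatRank u x y ≤ bruhatRank v x y := by
  induction h with
  | refl => exact le_rfl
  | tail _ harr ih =>
    obtain ⟨i, k, hik, hw, rfl⟩ := harr.exists_eq_mul_swap
    exact ih.trans (bruhatRank_le_mul_swap hik hw x y)

theorem parityRank_succ_left {n : ℕ} {e : ℕ} (w : Equiv.Perm (Fin n)) {x : ℕ} (hx : x % 2 ≠ e)
    (y : ℕ) : parityRank e w (x + 1) y = parityRank e w x y := by
  unfold parityRank
  congr 1
  ext j
  simp only [Finset.mem_filter, Finset.mem_univ, true_and]
  refine and_congr_right fun he => and_congr_left fun _ => ?_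
  have : (j : ℕ) ≠ x := by rintro rfl; exact hx he
  omega

theorem parityRank_succ_right {n : ℕ} {e : ℕ} (w : Equiv.Perm (Fin n)) (x : ℕ) {b : Fin n}
    (hb : ((w⁻¹ b : Fin n) : ℕ) % 2 ≠ e) :
    parityRank e w x (b + 1) = parityRank e w x b := by
  unfold parityRank
  congr 1
  ext j
  simp only [Finset.mem_filter, Finset.mem_univ, true_and]
  refine and_congr_right fun he => and_congr_right fun _ => ?_
  have : (w j : ℕ) ≠ b := by
    intro hc
    rw [← Fin.ext hc, perm_inv_apply] at hb
    exact hb he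
  omega

/-! ### Rank counts of two permutations with the same odd diagram -/

theorem parityRank_eq_of_le_position {n : ℕ} {w v : Equiv.Perm (Fin n)}
    (h : oddDiagram w = oddDiagram v) {e : ℕ} {m : Fin n} (hm : (m : ℕ) % 2 ≠ e) {x : ℕ}
    (hx : x ≤ m) : parityRank e w x (w m + 1) = parityRank e v x (w m + 1) := by
  unfold parityRank
  congr 1
  ext j
  simp only [Finset.mem_filter, Finset.mem_univ, true_and]
  refine and_congr_right fun he => and_congr_right fun hjx => ?_
  have := value_lt_apply_iff h (i := j) (m := m) (by omega) (Fin.lt_def.mpr (hjx.trans_le hx))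
  simp only [Fin.lt_def] at this
  omega

/-- Trades a count over positions for one over values, to which `position_lt_inv_iff` applies. -/
theorem parityRank_add_card {n : ℕ} (e : ℕ) (w : Equiv.Perm (Fin n)) (x y : ℕ) :
    parityRank e w x y + (Finset.univ.filter fun a : Fin n => (a : ℕ) < y ∧
      ((w⁻¹ a : Fin n) : ℕ) % 2 = e ∧ ((w⁻¹ a : Fin n) : ℕ) < x).card =
    (Finset.univ.filter fun j : Fin n => (j : ℕ) % 2 = e ∧ (j : ℕ) < x).card := by
  classical
  have h1 : (Finset.univ.filter fun a : Fin n => (a : ℕ) < y ∧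
      ((w⁻¹ a : Fin n) : ℕ) % 2 = e ∧ ((w⁻¹ a : Fin n) : ℕ) < x).card =
      (Finset.univ.filter fun j : Fin n => (j : ℕ) % 2 = e ∧ (j : ℕ) < x ∧ ¬ y ≤ w j).card := by
    refine Finset.card_bij (fun a _ => w⁻¹ a) ?_ (fun _ _ _ _ he => (w⁻¹).injective he) ?_
    · intro a ha
      simp only [Finset.mem_filter, Finset.mem_univ, true_and, perm_apply_inv] at ha ⊢
      exact ⟨ha.2.1, ha.2.2, not_le.mpr ha.1⟩
    · intro j hj
      simp only [Finset.mem_filter, Finset.mem_univ, true_and] at hj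
      refine ⟨w j, ?_, perm_inv_apply w j⟩
      simp only [Finset.mem_filter, Finset.mem_univ, true_and, perm_inv_apply]
      exact ⟨not_le.mp hj.2.2, hj.1, hj.2.1⟩
  rw [h1]
  unfold parityRank
  have := Finset.card_filter_add_card_filter_not
    (s := Finset.univ.filter fun j : Fin n => (j : ℕ) % 2 = e ∧ (j : ℕ) < x)
    (fun j => y ≤ (w j : ℕ))
  rw [Finset.filter_filter, Finset.filter_filter] at this
  simpa only [and_assoc] using this

theorem parityRank_eq_of_le_value {n : ℕ} {w v : Equiv.Perm (Fin n)}
    (h : oddDiagram w = oddDiagram v) {e : ℕ} {m : Fin n} (hm : (m : ℕ) % 2 ≠ e) {y : ℕ}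
    (hy : y ≤ w m) : parityRank e w m y = parityRank e v m y := by
  have h1 := parityRank_add_card e w m y
  have h2 := parityRank_add_card e v m y
  rw [← h2] at h1
  have h3 : (Finset.univ.filter fun a : Fin n => (a : ℕ) < y ∧
      ((w⁻¹ a : Fin n) : ℕ) % 2 = e ∧ ((w⁻¹ a : Fin n) : ℕ) < m) =
      (Finset.univ.filter fun a : Fin n => (a : ℕ) < y ∧
      ((v⁻¹ a : Fin n) : ℕ) % 2 = e ∧ ((v⁻¹ a : Fin n) : ℕ) < m) := by
    ext a
    simp only [Finset.mem_filter, Finset.mem_univ, true_and]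
    have hp := position_parity_eq h a
    rw [← hp]
    refine and_congr_right fun hay => and_congr_right fun he => ?_
    have := position_lt_inv_iff h (m := m) (a := a) (by omega) (Fin.lt_def.mpr (hay.trans_le hy))
    rw [Fin.lt_def, Fin.lt_def] at this
    have h4 : (m : ℕ) ≠ (w⁻¹ a : Fin n) := by
      intro hc
      rw [hc] at hm
      exact hm he
    have h5 : (m : ℕ) ≠ (v⁻¹ a : Fin n) := by
      intro hc
      rw [hc] at hm
      exact hm (hp ▸ he)
    omega
  rw [h3] at h1
  omega

/-! ### Rank differences are confined to one parity at each place -/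

/-- The positions of the dots of `z` strictly to the upper right of the dot `(i, w i)`, among the
positions of the other parity. -/
def upperRight {n : ℕ} (z w : Equiv.Perm (Fin n)) (i : Fin n) : Finset (Fin n) :=
  Finset.univ.filter fun m => (m : ℕ) % 2 ≠ (i : ℕ) % 2 ∧ i < m ∧ w i < z m

theorem mem_upperRight {n : ℕ} (z w : Equiv.Perm (Fin n)) (i m : Fin n) :
    m ∈ upperRight z w i ↔ (m : ℕ) % 2 ≠ (i : ℕ) % 2 ∧ i < m ∧ w i < z m := by
  simp [upperRight]

/-- Pass from the dot `(i, w i)` to `(i, v i)`, then to the dot of `w` with value `v i`. Neither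
move changes the set: comparing `w` and `v` each with `z`, no ray of an opposite-parity dot of `z`
is crossed. -/
theorem upperRight_inv_apply {n : ℕ} {w v z : Equiv.Perm (Fin n)}
    (hw : oddDiagram z = oddDiagram w) (hv : oddDiagram z = oddDiagram v) (i : Fin n) :
    upperRight z w (w⁻¹ (v i)) = upperRight z w i := by
  have hwv : oddDiagram w = oddDiagram v := hw.symm.trans hv
  have hp := parity_inv_apply hwv i
  ext m
  simp only [mem_upperRight, hp, perm_apply_inv]
  refine and_congr_right fun hm => ?_
  constructor
  · rintro ⟨h1, h2⟩
    have hz := parity_inv_apply hv i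
    have e1 := position_lt_inv_iff hw (m := m) (a := v i) (by omega) h2
    have e2 := position_lt_inv_iff hv (m := m) (a := v i) (by omega) h2
    rw [perm_inv_apply] at e2
    have him : i < m := by
      by_contra hc
      have hne : i ≠ m := by rintro rfl; exact hm rfl
      exact absurd (e1.mpr (e2.mp (lt_of_le_of_ne (not_lt.mp hc) hne.symm))) (not_lt.mpr h1.le)
    refine ⟨him, ?_⟩
    have f1 := value_lt_apply_iff hw (i := i) (m := m) (by omega) him
    have f2 := value_lt_apply_iff hv (i := i) (m := m) (by omega) him
    by_contra hc
    have hne := apply_ne_apply_of_parity_ne hw hm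
    exact absurd (f2.mpr (f1.mp (lt_of_le_of_ne (not_lt.mp hc) hne))) (not_lt.mpr h2.le)
  · rintro ⟨him, h2⟩
    have f1 := value_lt_apply_iff hw (i := i) (m := m) (by omega) him
    have f2 := value_lt_apply_iff hv (i := i) (m := m) (by omega) him
    have h3 : v i < z m := by
      by_contra hc
      have hne := apply_ne_apply_of_parity_ne hv hm
      exact absurd (f1.mpr (f2.mp (lt_of_le_of_ne (not_lt.mp hc) hne))) (not_lt.mpr h2.le)
    refine ⟨?_, h3⟩
    have hz := parity_inv_apply hv i
    have e1 := position_lt_inv_iff hw (m := m) (a := v i) (by omega) h3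
    have e2 := position_lt_inv_iff hv (m := m) (a := v i) (by omega) h3
    rw [perm_inv_apply] at e2
    by_contra hc
    have hne : m ≠ w⁻¹ (v i) := by rintro rfl; exact hm hp
    exact absurd (e2.mpr (e1.mp (lt_of_le_of_ne (not_lt.mp hc) hne))) (not_lt.mpr him.le)

/-- Without the first dot, every position of `P` below `x` would count for `w`; without the second,
`w⁻¹ ∘ v` would inject the dots counted for `v` into those counted for `w`. -/
theorem exists_dots_of_card_lt {n : ℕ} {w v : Equiv.Perm (Fin n)} {P : Finset (Fin n)} {x y : ℕ}
    (hP : ∀ i ∈ P, w⁻¹ (v i) ∈ P)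
    (hlt : (P.filter fun j : Fin n => (j : ℕ) < x ∧ y ≤ w j).card <
      (P.filter fun j : Fin n => (j : ℕ) < x ∧ y ≤ v j).card) :
    (∃ i ∈ P, (i : ℕ) < x ∧ (w i : ℕ) < y) ∧ ∃ i ∈ P, x ≤ (i : ℕ) ∧ y ≤ (w i : ℕ) := by
  classical
  constructor
  · by_contra hc
    push Not at hc
    refine absurd hlt (not_lt.mpr (Finset.card_le_card ?_))
    intro j hj
    simp only [Finset.mem_filter] at hj ⊢
    exact ⟨hj.1, hj.2.1, hc j hj.1 hj.2.1⟩
  · by_contra hc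
    push Not at hc
    refine absurd hlt (not_lt.mpr ?_)
    refine Finset.card_le_card_of_injOn (fun i => w⁻¹ (v i)) ?_
      ((w⁻¹).injective.comp v.injective).injOn
    intro j hj
    simp only [Finset.mem_coe, Finset.mem_filter, perm_apply_inv] at hj ⊢
    refine ⟨hP j hj.1, ?_, hj.2.2⟩
    by_contra hx
    have := hc _ (hP j hj.1) (not_lt.mp hx)
    rw [perm_apply_inv] at this
    omega

theorem exists_dots_of_parityRank_lt {n : ℕ} {w v z : Equiv.Perm (Fin n)}
    (hw : oddDiagram z = oddDiagram w) (hv : oddDiagram z = oddDiagram v) {e x y : ℕ}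
    (hlt : parityRank e w x y < parityRank e v x y) :
    ∃ i k : Fin n, (i : ℕ) % 2 = e ∧ (k : ℕ) % 2 = e ∧ (i : ℕ) < x ∧ (w i : ℕ) < y ∧
      x ≤ (k : ℕ) ∧ y ≤ (w k : ℕ) ∧ upperRight z w i = upperRight z w k := by
  classical
  -- The count splits over the fibres of `upperRight z w`, which `w⁻¹ ∘ v` preserves; a strict
  -- inequality survives in some fibre.
  have hfib : ∀ u : Equiv.Perm (Fin n), parityRank e u x y =
      ∑ S : Finset (Fin n), ((Finset.univ.filter fun i : Fin n =>
        (i : ℕ) % 2 = e ∧ upperRight z w i = S).filter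
          fun j : Fin n => (j : ℕ) < x ∧ y ≤ u j).card := by
    intro u
    unfold parityRank
    rw [Finset.card_eq_sum_card_fiberwise (f := upperRight z w) (t := Finset.univ)
      (fun _ _ => Finset.mem_coe.mpr (Finset.mem_univ _))]
    refine Finset.sum_congr rfl fun S _ => ?_
    congr 1
    ext j
    simp only [Finset.mem_filter, Finset.mem_univ, true_and]
    tauto
  rw [hfib w, hfib v] at hlt
  obtain ⟨S, -, hS⟩ := Finset.exists_lt_of_sum_lt hlt
  obtain ⟨⟨i, hi, hix, hiy⟩, k, hk, hkx, hky⟩ := exists_dots_of_card_lt (by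
    intro i hi
    simp only [Finset.mem_filter, Finset.mem_univ, true_and] at hi ⊢
    rw [upperRight_inv_apply hw hv, parity_inv_apply (hw.symm.trans hv)]
    exact hi) hS
  simp only [Finset.mem_filter, Finset.mem_univ, true_and] at hi hk
  exact ⟨i, k, hi.1, hk.1, hix, hiy, hkx, hky, hi.2.trans hk.2.symm⟩

/-- The place `(x, y)` separates `i` from `q`, so `q` is to the upper right of `i`, hence also of
its fibre mate `k`; symmetrically `k` is to the upper right of `q`. Two pairs of permutations are
allowed so as to cover all sign combinations. -/
theorem not_parityRank_lt_and_lt {n : ℕ} {w v w' v' : Equiv.Perm (Fin n)}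
    (hv : oddDiagram w = oddDiagram v) (hw' : oddDiagram w = oddDiagram w')
    (hv' : oddDiagram w = oddDiagram v') {e f x y : ℕ} (hef : e ≠ f)
    (h1 : parityRank e w x y < parityRank e v x y)
    (h2 : parityRank f w' x y < parityRank f v' x y) : False := by
  obtain ⟨i, k, hi, hk, hix, hiy, hkx, hky, hik⟩ :=
    exists_dots_of_parityRank_lt (z := w') hw'.symm (hw'.symm.trans hv) h1
  obtain ⟨p, q, hp, hq, hpx, hpy, hqx, hqy, hpq⟩ :=
    exists_dots_of_parityRank_lt (z := w) hw' hv' h2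
  have hqk : q ∈ upperRight w' w k := by
    rw [← hik, mem_upperRight, Fin.lt_def, Fin.lt_def]
    omega
  have hkq : k ∈ upperRight w w' q := by
    rw [← hpq, mem_upperRight, Fin.lt_def, Fin.lt_def]
    omega
  exact absurd ((mem_upperRight _ _ _ _).mp hqk).2.1
    (not_lt.mpr ((mem_upperRight _ _ _ _).mp hkq).2.1.le)

/-- The rank counts of two permutations with the same odd diagram never differ in both parities
at the same place. -/
theorem parityRank_eq_or_eq {n : ℕ} {w v : Equiv.Perm (Fin n)} (h : oddDiagram w = oddDiagram v)
    {e f : ℕ} (hef : e ≠ f) (x y : ℕ) :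
    parityRank e w x y = parityRank e v x y ∨ parityRank f w x y = parityRank f v x y := by
  by_contra hc
  push Not at hc
  rcases lt_or_gt_of_ne hc.1 with h1 | h1 <;> rcases lt_or_gt_of_ne hc.2 with h2 | h2
  · exact not_parityRank_lt_and_lt h rfl h hef h1 h2
  · exact not_parityRank_lt_and_lt h h rfl hef h1 h2
  · exact not_parityRank_lt_and_lt h.symm h.symm rfl hef h1 h2
  · exact not_parityRank_lt_and_lt h.symm rfl h.symm hef h1 h2

/-! ### Convexity -/

/-- On a rectangle where the total rank counts differ, the parity in which they differ is
constant. -/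
theorem parityRank_eq_iff_of_mem_rectangle {n : ℕ} {w v : Equiv.Perm (Fin n)}
    (h : oddDiagram w = oddDiagram v) {x₁ x₂ y₁ y₂ : ℕ} (hn : y₂ ≤ n)
    (hne : ∀ x y, x₁ ≤ x → x ≤ x₂ → y₁ ≤ y → y ≤ y₂ → bruhatRank w x y ≠ bruhatRank v x y)
    {e : ℕ} (he : e < 2) {x y x' y' : ℕ} (hx : x₁ ≤ x) (hx₂ : x ≤ x₂) (hy : y₁ ≤ y)
    (hy₂ : y ≤ y₂) (hx' : x₁ ≤ x') (hx₂' : x' ≤ x₂) (hy' : y₁ ≤ y') (hy₂' : y' ≤ y₂) :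
    parityRank e w x y = parityRank e v x y ↔ parityRank e w x' y' = parityRank e v x' y' := by
  have hf : 1 - e < 2 := by omega
  have hef : e ≠ 1 - e := by omega
  -- In the rectangle exactly one parity differs. A unit step in `x` or `y` can change the counts of
  -- one parity only, so agreement is carried across by the other parity.
  have hiff : ∀ x y, x₁ ≤ x → x ≤ x₂ → y₁ ≤ y → y ≤ y₂ →
      (parityRank e w x y = parityRank e v x y ↔
        parityRank (1 - e) w x y ≠ parityRank (1 - e) v x y) := by
    intro x y h1 h2 h3 h4
    have h5 := hne x y h1 h2 h3 h4
    rw [bruhatRank_eq_add w x y he hf hef, bruhatRank_eq_add v x y he hf hef] at h5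
    rcases parityRank_eq_or_eq h hef x y with h6 | h6 <;> omega
  have hstepx : ∀ x y, x₁ ≤ x → x + 1 ≤ x₂ → y₁ ≤ y → y ≤ y₂ →
      (parityRank e w x y = parityRank e v x y ↔
        parityRank e w (x + 1) y = parityRank e v (x + 1) y) := by
    intro x y h1 h2 h3 h4
    by_cases hp : x % 2 = e
    · rw [hiff x y h1 (by omega) h3 h4, hiff (x + 1) y (by omega) h2 h3 h4,
        parityRank_succ_left w (by omega), parityRank_succ_left v (by omega)]
    · rw [parityRank_succ_left w hp, parityRank_succ_left v hp]
  have hstepy : ∀ x y, x₁ ≤ x → x ≤ x₂ → y₁ ≤ y → y + 1 ≤ y₂ →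
      (parityRank e w x y = parityRank e v x y ↔
        parityRank e w x (y + 1) = parityRank e v x (y + 1)) := by
    intro x y h1 h2 h3 h4
    have hpw := position_parity_eq h ⟨y, by omega⟩
    by_cases hp : ((w⁻¹ (⟨y, by omega⟩ : Fin n) : Fin n) : ℕ) % 2 = e
    · have e1 := parityRank_succ_right (e := 1 - e) w x (b := ⟨y, by omega⟩) (by omega)
      have e2 := parityRank_succ_right (e := 1 - e) v x (b := ⟨y, by omega⟩) (by omega)
      simp only at e1 e2
      rw [hiff x y h1 h2 h3 (by omega), hiff x (y + 1) h1 h2 (by omega) h4, e1, e2]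
    · have e1 := parityRank_succ_right w x hp
      have e2 := parityRank_succ_right v x (hpw ▸ hp)
      simp only at e1 e2
      rw [e1, e2]
  have hxx : ∀ x y, x₁ ≤ x → x ≤ x₂ → y₁ ≤ y → y ≤ y₂ →
      (parityRank e w x₁ y = parityRank e v x₁ y ↔
        parityRank e w x y = parityRank e v x y) := by
    intro x y h1 h2 h3 h4
    induction x, h1 using Nat.le_induction with
    | base => rfl
    | succ x h1 ih => rw [ih (by omega), hstepx x y h1 h2 h3 h4]
  have hyy : ∀ x y, x₁ ≤ x → x ≤ x₂ → y₁ ≤ y → y ≤ y₂ →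
      (parityRank e w x y₁ = parityRank e v x y₁ ↔
        parityRank e w x y = parityRank e v x y) := by
    intro x y h1 h2 h3 h4
    induction y, h3 using Nat.le_induction with
    | base => rfl
    | succ y h3 ih => rw [ih (by omega), hstepy x y h1 h2 h3 h4]
  rw [← hyy x y hx hx₂ hy hy₂, ← hyy x' y' hx' hx₂' hy' hy₂',
    ← hxx x y₁ hx hx₂ le_rfl (by omega), ← hxx x' y₁ hx' hx₂' le_rfl (by omega)]

theorem linked_of_bruhatRank_le {n : ℕ} {w v : Equiv.Perm (Fin n)}
    (h : oddDiagram w = oddDiagram v) {i k : Fin n} (hik : i < k) (hw : w i < w k)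
    (hle : ∀ x y, bruhatRank (w * Equiv.swap i k) x y ≤ bruhatRank v x y) : Linked w i k := by
  rw [Fin.lt_def] at hik hw
  have hkn := (w k).isLt
  have hne : ∀ x y, (i : ℕ) + 1 ≤ x → x ≤ k → (w i : ℕ) + 1 ≤ y → y ≤ w k →
      bruhatRank w x y ≠ bruhatRank v x y := by
    intro x y h1 h2 h3 h4
    have h5 := hle x y
    rw [bruhatRank_mul_swap h1 h2 h3 h4] at h5
    omega
  have hconst := fun {e : ℕ} (he : e < 2) {x y x' y' : ℕ} =>
    parityRank_eq_iff_of_mem_rectangle h hkn.le hne he (x := x) (y := y) (x' := x') (y' := y')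
  have hsome : ∀ x y, (i : ℕ) + 1 ≤ x → x ≤ k → (w i : ℕ) + 1 ≤ y → y ≤ w k → ∀ e f, e < 2 →
      f < 2 → e ≠ f → parityRank e w x y = parityRank e v x y →
      parityRank f w x y ≠ parityRank f v x y := by
    intro x y h1 h2 h3 h4 e f he hf hef h5 h6
    apply hne x y h1 h2 h3 h4
    rw [bruhatRank_eq_add w x y he hf hef, bruhatRank_eq_add v x y he hf hef, h5, h6]
  -- With opposite parities, the ray of the dot at `k` gives agreement in the parity of `i` at one
  -- corner, and the ray of the dot at `i` gives agreement in the parity of `k` at the opposite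
  -- corner; constancy puts both at one place.
  have hpar : (i : ℕ) % 2 = (k : ℕ) % 2 := by
    by_contra hc
    have h1 := parityRank_eq_of_le_value h (Ne.symm hc) (le_refl (w k : ℕ))
    have h2 := (hconst (by omega) (x' := i + 1) (y' := w i + 1) (by omega) le_rfl (by omega)
      le_rfl le_rfl (by omega) le_rfl (by omega)).mp h1
    refine hsome _ _ le_rfl (by omega) le_rfl (by omega) _ _ (by omega) (by omega) hc h2 ?_
    rw [parityRank_succ_left w hc, parityRank_succ_left v hc]
    exact parityRank_eq_of_le_position h hc le_rfl
  -- The ray of the dot at `k` makes the other parity agree at this corner, so the parity of `i`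
  -- differs here and then on the whole rectangle. An opposite-parity dot violating `Linked` has a
  -- ray meeting the rectangle, where that parity would agree.
  have hcor : parityRank ((i : ℕ) % 2) w k (w k) ≠ parityRank ((i : ℕ) % 2) v k (w k) := by
    have hb : ((w⁻¹ (w k) : Fin n) : ℕ) % 2 ≠ 1 - (i : ℕ) % 2 := by
      rw [perm_inv_apply]
      omega
    have hb' : ((v⁻¹ (w k) : Fin n) : ℕ) % 2 ≠ 1 - (i : ℕ) % 2 := by
      rwa [← position_parity_eq h (w k)]
    refine hsome _ _ (by omega) le_rfl (by omega) le_rfl (1 - (i : ℕ) % 2) _ (by omega) (by omega)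
      (by omega) ?_
    rw [← parityRank_succ_right w _ hb, ← parityRank_succ_right v _ hb']
    exact parityRank_eq_of_le_position h (by omega) le_rfl
  have hall : ∀ x y, (i : ℕ) + 1 ≤ x → x ≤ k → (w i : ℕ) + 1 ≤ y → y ≤ w k →
      parityRank ((i : ℕ) % 2) w x y ≠ parityRank ((i : ℕ) % 2) v x y :=
    fun x y h1 h2 h3 h4 h5 => hcor ((hconst (by omega) h1 h2 h3 h4 (by omega) le_rfl
      (by omega) le_rfl).mp h5)
  refine ⟨hpar, hik, fun m hm him => ⟨fun hmk => ?_, fun hkm => ?_⟩⟩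
  · have hlt : w m < w i := by
      by_contra hc
      have hne' : w i ≠ w m := fun he => him.ne (w.injective he)
      have hlt : w i < w m := lt_of_le_of_ne (not_lt.mp hc) hne'
      rw [Fin.lt_def] at hlt him hmk
      exact hall m (w i + 1) him hmk.le le_rfl hw (parityRank_eq_of_le_value h hm hlt)
    exact ⟨hlt, hlt.trans (Fin.lt_def.mpr hw)⟩
  · refine ⟨fun h1 => h1.trans (Fin.lt_def.mpr hw), fun h1 => ?_⟩
    by_contra hc
    have hne' : w i ≠ w m := fun he => him.ne (w.injective he)
    have hlt : w i < w m := lt_of_le_of_ne (not_lt.mp hc) hne'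
    rw [Fin.lt_def] at hlt h1 hkm
    exact hall k (w m + 1) hik le_rfl (by omega) h1
      (parityRank_eq_of_le_position h hm hkm.le)

/-- Climb a chain from `u` to `z`: the target of each arrow is still below `v`, so its ranks are
bounded by those of `v` and the arrow is a linked swap. -/
theorem oddDiagram_eq_of_bruhatLE {n : ℕ} {u v z : Equiv.Perm (Fin n)}
    (h : oddDiagram u = oddDiagram v) (hz : BruhatLE u z) (hzv : BruhatLE z v) :
    oddDiagram z = oddDiagram v := by
  induction hz with
  | refl => exact h
  | tail _ harr ih =>
    have hy := ih (Relation.ReflTransGen.head harr hzv)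
    obtain ⟨i, k, hik, hw, rfl⟩ := harr.exists_eq_mul_swap
    rw [← hy]
    exact oddDiagram_mul_swap (linked_of_bruhatRank_le hy hik hw hzv.bruhatRank_le)

theorem theorem1p2 (n : ℕ) (D : Set (Fin n × Fin n)) (hD : IsOddDiagram D) :
    ∃ u v : Equiv.Perm (Fin n), BruhatLE u v ∧ oddDiagramClass D = bruhatInterval u v := by
  obtain ⟨w₀, rfl⟩ := hD
  obtain ⟨u, hu, hmin⟩ := exists_bruhat_least w₀
  obtain ⟨v, hv, hmax⟩ := exists_bruhat_greatest w₀
  refine ⟨u, v, hmin v hv, Set.ext fun z => ⟨fun hz => ⟨hmin z hz, hmax z hz⟩, fun hz => ?_⟩⟩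
  exact (oddDiagram_eq_of_bruhatLE (hu.trans hv.symm) hz.1 hz.2).trans hv
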